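/- Let $L^2(0,1)$ be the complex Hilbert space of square-integrable functions on $(0,1)$, and let $T_0$ be the operator in $L^2(0,1)$ with $$\mathcal D(T_0)=\{g\in L^2(0,1) : g\in AC[0,1],\ g'\in L^2(0,1),\ g(0)=g(1)=0\},\qquad T_0g=g',$$ with adjoint $T_0^*$. On the Hilbert space $X=L^2(0,1)\oplus L^2(0,1)$ let $$A=\begin{pmatrix}0&T_0^*\\ T_0&0\end{pmatrix},\qquad \mathcal D(A)=\mathcal D(T_0)\times\mathcal D(T_0^*),$$ and on $X\oplus X=(L^2(0,1))^4$ let $$H=\begin{pmatrix}A&A+1\\ 0&-A\end{pmatrix},\qquad \mathcal D(H)=\mathcal D(A)\times\mathcal D(A).$$ A Hamiltonian operator matrix on $X\oplus X$ is a block operator matrix $\begin{pmatrix}A_1&B_1\\ C_1&-A_1^*\end{pmatrix}$ with domain $(\mathcal D(A_1)\cap\mathcal D(C_1))\times(\mathcal D(B_1)\cap\mathcal D(A_1^*))$, such that $A_1,B_1,C_1$ are closed and densely defined, $B_1,C_1$ are self-adjoint, and the block operator matrix is densely defined. A Hamiltonian operator matrix $K$ is called symplectic self-adjoint if $JK=(JK)^*$,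 where $J=\begin{pmatrix}0&I\\-I&0\end{pmatrix}$. Then: 1. $H$ is a Hamiltonian operator matrix and it is symplectic self-adjoint. 2. $\sigma(H)=\sigma_p(H)=\{k\pi : k\in\mathbb Z\}$, and every $\lambda\in\sigma(H)$ is an eigenvalue of finite algebraic multiplicity, i.e. the root subspace $\bigcup_{n\ge 0}\ker (H-\lambda)^n$ is finite-dimensional. Here $\sigma(H)$ is the complement of the set of $\lambda\in\mathbb C$ for which $H-\lambda$ is a bijection of $\mathcal D(H)$ onto $X\oplus X$ with bounded inverse, and $\sigma_p(H)$ is the set of eigenvalues of $H$. -/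

import Mathlib

open MeasureTheory

noncomputable section

namespace PlateBending

/-! ### Block operator matrices -/

section Block

variable {X₁ X₂ : Type*}
  [NormedAddCommGroup X₁] [InnerProductSpace ℂ X₁]
  [NormedAddCommGroup X₂] [InnerProductSpace ℂ X₂]

/-- The domain `(D(A) ∩ D(C)) × (D(B) ∩ D(D))` of the block operator matrix `[[A, B], [C, D]]`. -/
def blockDomain (A : X₁ →ₗ.[ℂ] X₁) (B : X₂ →ₗ.[ℂ] X₁) (C : X₁ →ₗ.[ℂ] X₂) (D : X₂ →ₗ.[ℂ] X₂) :
    Submodule ℂ (WithLp 2 (X₁ × X₂)) where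
  carrier := {x | (x.fst ∈ A.domain ∧ x.fst ∈ C.domain) ∧ (x.snd ∈ B.domain ∧ x.snd ∈ D.domain)}
  zero_mem' := ⟨⟨A.domain.zero_mem, C.domain.zero_mem⟩, B.domain.zero_mem, D.domain.zero_mem⟩
  add_mem' := fun hx hy =>
    ⟨⟨A.domain.add_mem hx.1.1 hy.1.1, C.domain.add_mem hx.1.2 hy.1.2⟩,
      B.domain.add_mem hx.2.1 hy.2.1, D.domain.add_mem hx.2.2 hy.2.2⟩
  smul_mem' := fun c _ hx =>
    ⟨⟨A.domain.smul_mem c hx.1.1, C.domain.smul_mem c hx.1.2⟩,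
      B.domain.smul_mem c hx.2.1, D.domain.smul_mem c hx.2.2⟩

/-- The unbounded operator on the Hilbert space sum `X₁ ⊕ X₂` induced by the matrix
`[[A, B], [C, D]]`: it maps `(x₁, x₂)` to `(A x₁ + B x₂, C x₁ + D x₂)`. -/
def blockOperator (A : X₁ →ₗ.[ℂ] X₁) (B : X₂ →ₗ.[ℂ] X₁) (C : X₁ →ₗ.[ℂ] X₂) (D : X₂ →ₗ.[ℂ] X₂) :
    WithLp 2 (X₁ × X₂) →ₗ.[ℂ] WithLp 2 (X₁ × X₂) where
  domain := blockDomain A B C D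
  toFun :=
    { toFun := fun x => WithLp.toLp 2
        (A ⟨x.1.fst, x.2.1.1⟩ + B ⟨x.1.snd, x.2.2.1⟩,
          C ⟨x.1.fst, x.2.1.2⟩ + D ⟨x.1.snd, x.2.2.2⟩)
      map_add' := fun x y => by
        have hA := A.map_add ⟨x.1.fst, x.2.1.1⟩ ⟨y.1.fst, y.2.1.1⟩
        have hB := B.map_add ⟨x.1.snd, x.2.2.1⟩ ⟨y.1.snd, y.2.2.1⟩
        have hC := C.map_add ⟨x.1.fst, x.2.1.2⟩ ⟨y.1.fst, y.2.1.2⟩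
        have hD := D.map_add ⟨x.1.snd, x.2.2.2⟩ ⟨y.1.snd, y.2.2.2⟩
        apply WithLp.ofLp_injective 2
        exact Prod.ext ((congrArg₂ (· + ·) hA hB).trans (add_add_add_comm _ _ _ _))
          ((congrArg₂ (· + ·) hC hD).trans (add_add_add_comm _ _ _ _))
      map_smul' := fun c x => by
        have hA := A.map_smul c ⟨x.1.fst, x.2.1.1⟩
        have hB := B.map_smul c ⟨x.1.snd, x.2.2.1⟩
        have hC := C.map_smul c ⟨x.1.fst, x.2.1.2⟩
        have hD := D.map_smul c ⟨x.1.snd, x.2.2.2⟩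
        apply WithLp.ofLp_injective 2
        exact Prod.ext ((congrArg₂ (· + ·) hA hB).trans (smul_add c _ _).symm)
          ((congrArg₂ (· + ·) hC hD).trans (smul_add c _ _).symm) }

end Block

/-! ### Hamiltonian operator matrices and symplectic self-adjointness -/

section Hamiltonian

variable {X : Type*} [NormedAddCommGroup X] [InnerProductSpace ℂ X]

/-- The unit symplectic operator matrix `J = [[0, I], [-I, 0]]`. -/
def symplecticUnit (X : Type*) [NormedAddCommGroup X] [InnerProductSpace ℂ X] :
    WithLp 2 (X × X) →ₗ[ℂ] WithLp 2 (X × X) where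
  toFun x := WithLp.toLp 2 (x.snd, -x.fst)
  map_add' x y := WithLp.ofLp_injective 2 (Prod.ext rfl (neg_add x.fst y.fst))
  map_smul' c x := WithLp.ofLp_injective 2 (Prod.ext rfl (smul_neg c x.fst).symm)

/-- `[[A, B], [C, D]]` is a Hamiltonian operator matrix: `A`, `B`, `C` are closed and densely
defined, `B` and `C` are self-adjoint, `D = -A*`, and the induced operator is densely defined. -/
structure IsHamiltonian [CompleteSpace X] (A B C D : X →ₗ.[ℂ] X) : Prop where
  closed_A : A.IsClosed
  closed_B : B.IsClosed
  closed_C : C.IsClosed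
  dense_A : Dense (A.domain : Set X)
  dense_B : Dense (B.domain : Set X)
  dense_C : Dense (C.domain : Set X)
  selfAdjoint_B : IsSelfAdjoint B
  selfAdjoint_C : IsSelfAdjoint C
  eq_neg_adjoint : D = -A.adjoint
  dense_block : Dense ((blockOperator A B C D).domain : Set (WithLp 2 (X × X)))

/-- `H = [[A, B], [C, D]]` is a symplectic self-adjoint Hamiltonian operator matrix:
it is a Hamiltonian operator matrix and `JH = (JH)*`. -/
def IsSymplecticSelfAdjoint [CompleteSpace X] (A B C D : X →ₗ.[ℂ] X) : Prop :=
  IsHamiltonian A B C D ∧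
    ((symplecticUnit X).compPMap (blockOperator A B C D)).adjoint =
      (symplecticUnit X).compPMap (blockOperator A B C D)

end Hamiltonian

/-! ### Spectral notions for unbounded operators -/

section Spectrum

variable {Y : Type*} [NormedAddCommGroup Y] [NormedSpace ℂ Y]

/-- The resolvent set: `T - z` has an everywhere defined bounded two-sided inverse `R`. -/
def resolventSet (T : Y →ₗ.[ℂ] Y) : Set ℂ :=
  {z | ∃ R : Y →L[ℂ] Y,
    (∀ y : Y, ∃ h : R y ∈ T.domain, T ⟨R y, h⟩ - z • R y = y) ∧
    ∀ x : T.domain, R (T x - z • (x : Y)) = x}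

/-- The spectrum `σ(T)`. -/
def spectrumSet (T : Y →ₗ.[ℂ] Y) : Set ℂ := (resolventSet T)ᶜ

/-- The point spectrum `σ_p(T)`, the set of eigenvalues. -/
def pointSpectrum (T : Y →ₗ.[ℂ] Y) : Set ℂ :=
  {z | ∃ x : T.domain, (x : Y) ≠ 0 ∧ T x = z • (x : Y)}

/-- The kernel of `(T - z) ^ n`, on its natural domain `D(T ^ n)`. -/
def kerPow (T : Y →ₗ.[ℂ] Y) (z : ℂ) : ℕ → Submodule ℂ Y
  | 0 => ⊥
  | n + 1 =>
    { carrier := {x | ∃ h : x ∈ T.domain, T ⟨x, h⟩ - z • x ∈ kerPow T z n}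
      zero_mem' := ⟨T.domain.zero_mem, by
        have h0 : T ⟨0, T.domain.zero_mem⟩ = 0 := T.map_zero
        rw [h0, smul_zero, sub_zero]
        exact (kerPow T z n).zero_mem⟩
      add_mem' := by
        rintro x y ⟨hx, hx'⟩ ⟨hy, hy'⟩
        refine ⟨T.domain.add_mem hx hy, ?_⟩
        have h0 : T ⟨x + y, T.domain.add_mem hx hy⟩ = T ⟨x, hx⟩ + T ⟨y, hy⟩ :=
          T.map_add ⟨x, hx⟩ ⟨y, hy⟩
        rw [h0, smul_add, add_sub_add_comm]
        exact (kerPow T z n).add_mem hx' hy'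
      smul_mem' := by
        rintro c x ⟨hx, hx'⟩
        refine ⟨T.domain.smul_mem c hx, ?_⟩
        have h0 : T ⟨c • x, T.domain.smul_mem c hx⟩ = c • T ⟨x, hx⟩ := T.map_smul c ⟨x, hx⟩
        rw [h0, smul_comm z c x, ← smul_sub]
        exact (kerPow T z n).smul_mem c hx' }

/-- The root subspace `⋃ₙ ker (T - z) ^ n` (an increasing union); its dimension is the algebraic
multiplicity of the eigenvalue `z`. -/
def rootSubspace (T : Y →ₗ.[ℂ] Y) (z : ℂ) : Submodule ℂ Y := ⨆ n : ℕ, kerPow T z n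

end Spectrum

/-! ### The operators of the plate bending problem -/

/-- The complex Hilbert space `L²(0, 1)`. -/
abbrev L2 : Type := Lp ℂ 2 (volume.restrict (Set.Ioo (0 : ℝ) 1))

/-- The graph of `d/dy` with Dirichlet conditions: the pairs `(g, h)` in `L²(0, 1) × L²(0, 1)` such
that `g` has a representative `f` absolutely continuous on `[0, 1]` with `f(0) = f(1) = 0` and
`f' = h` almost everywhere on `(0, 1)`. -/
def dirichletGraph : Submodule ℂ (L2 × L2) where
  carrier := {p | ∃ f : ℝ → ℂ, AbsolutelyContinuousOnInterval f 0 1 ∧ f 0 = 0 ∧ f 1 = 0 ∧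
    p.1 =ᵐ[volume.restrict (Set.Ioo (0 : ℝ) 1)] f ∧
    ∀ᵐ y ∂(volume.restrict (Set.Ioo (0 : ℝ) 1)), HasDerivAt f (p.2 y) y}
  zero_mem' := by
    refine ⟨fun _ => 0, ?_, rfl, rfl, Lp.coeFn_zero _ _ _, ?_⟩
    · exact (contDiff_const.contDiffOn).absolutelyContinuousOnInterval
    · filter_upwards [Lp.coeFn_zero ℂ 2 (volume.restrict (Set.Ioo (0 : ℝ) 1))] with y hy
      change HasDerivAt _ ((0 : L2) y) y
      rw [hy]
      exact hasDerivAt_const y 0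
  add_mem' := by
    rintro p q ⟨f, hf, hf0, hf1, hpf, hf'⟩ ⟨g, hg, hg0, hg1, hqg, hg'⟩
    refine ⟨f + g, hf.add hg, by simp [hf0, hg0], by simp [hf1, hg1],
      (Lp.coeFn_add _ _).trans (hpf.add hqg), ?_⟩
    filter_upwards [Lp.coeFn_add p.2 q.2, hf', hg'] with y hy h1 h2
    change HasDerivAt _ ((p.2 + q.2 : L2) y) y
    rw [hy]
    exact h1.add h2
  smul_mem' := by
    rintro c p ⟨f, hf, hf0, hf1, hpf, hf'⟩
    refine ⟨fun y => c • f y, hf.const_smul c, by simp [hf0], by simp [hf1],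
      (Lp.coeFn_smul _ _).trans (hpf.const_smul c), ?_⟩
    filter_upwards [Lp.coeFn_smul c p.2, hf'] with y hy h1
    change HasDerivAt _ ((c • p.2 : L2) y) y
    rw [hy]
    exact h1.const_smul c

/-- The operator `T₀ = d/dy` in `L²(0, 1)` with Dirichlet boundary conditions. -/
def T₀ : L2 →ₗ.[ℂ] L2 := dirichletGraph.toLinearPMap

/-- The derivative of a function in the domain is well defined. -/
theorem dirichletGraph_single_valued (p : L2 × L2) (hp : p ∈ dirichletGraph) (h0 : p.1 = 0) :
    p.2 = 0 := by
  obtain ⟨f, hf, -, -, hpf, hf'⟩ := hp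
  have hae : f =ᵐ[volume.restrict (Set.Ioo (0 : ℝ) 1)] fun _ => (0 : ℂ) := by
    rw [h0] at hpf
    exact hpf.symm.trans (Lp.coeFn_zero _ _ _)
  have hcont : ContinuousOn f (Set.Ioo (0 : ℝ) 1) :=
    hf.continuousOn.mono (by rw [Set.uIcc_of_le zero_le_one]; exact Set.Ioo_subset_Icc_self)
  have heq : Set.EqOn f (fun _ => (0 : ℂ)) (Set.Ioo (0 : ℝ) 1) :=
    Measure.eqOn_open_of_ae_eq hae isOpen_Ioo hcont continuousOn_const
  rw [Lp.eq_zero_iff_ae_eq_zero]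
  filter_upwards [hf', ae_restrict_mem measurableSet_Ioo] with y hy hmem
  have h1 : HasDerivAt f 0 y :=
    (hasDerivAt_const y (0 : ℂ)).congr_of_eventuallyEq
      (heq.eventuallyEq_of_mem (isOpen_Ioo.mem_nhds hmem))
  exact hy.unique h1

/-- The graph of `T₀` is the intended one. -/
theorem T₀_graph : T₀.graph = dirichletGraph :=
  Submodule.toLinearPMap_graph_eq _ dirichletGraph_single_valued

/-- The Hilbert space `L²(0, 1) ⊕ L²(0, 1)`. -/
abbrev X : Type := WithLp 2 (L2 × L2)

/-- `A = [[0, T₀*], [T₀, 0]]`. -/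
def A : X →ₗ.[ℂ] X := blockOperator 0 T₀.adjoint T₀ 0

/-- The identity operator, defined on all of `X`. -/
def one : X →ₗ.[ℂ] X := (LinearMap.id : X →ₗ[ℂ] X).toPMap ⊤

/-- `H = [[A, A + 1], [0, -A]]` in the Hilbert space `X ⊕ X = (L²(0, 1))⁴`. -/
def H : WithLp 2 (X × X) →ₗ.[ℂ] WithLp 2 (X × X) := blockOperator A (A + one) 0 (-A)

end PlateBending

end

/-!
`A` is symmetric because `T₀*` is a formal adjoint of `T₀`, and everything else is read off from the
range of `A - z`. Integration by parts for absolutely continuous functions shows that `T₀*` extends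
`-d/dx` on absolutely continuous functions with derivative in `L²`, without boundary conditions.
Hence `(A - z)(u, v) = (a, b)` follows from the boundary value problem `-v' - z u = a`,
`u' - z v = b`, `u(0) = u(1) = 0`, which variation of constants solves under one scalar condition
(`exists_A_sub_smul_eq`). For `z ∉ πℤ` a free constant makes the condition hold, so `A - z` is onto
(`A_sub_smul_surjective`). For `z = kπ` the condition is orthogonality to the eigenvector
`(sin kπx, cos kπx)`, so that this eigenvector spans `ker (A - kπ)` (`exists_span_A_eigenvector`);
no description of the domain of `T₀*` is needed.

Self-adjointness. A symmetric operator `S` is self-adjoint if `S - B` and `S - B*` are onto for some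
everywhere defined `B` (`adjoint_eq_self_of_surjective`). With scalar `B` this covers `A`, `A + 1`
and `0`; with `B = J` and `B* = -J` it covers `JH`, as `JH ∓ J = J (H ∓ 1)` and `±1 ∉ πℤ`.

Spectrum. For `z ∉ πℤ` the inverses of `A - z` and `A + z` are bounded by the closed graph theorem,
and `H - z` is inverted by back substitution (`mem_resolventSet_H`). An eigenvector `x` of `A` gives
the eigenvector `(x, 0)` of `H`, so `πℤ ⊆ σ_p(H) ⊆ σ(H) ⊆ πℤ`.

Multiplicity. Let `U` be the sum of `ker (A - kπ)` and `ker (A + kπ)`. By symmetry of `A`, a vector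
that `A ∓ kπ` maps into `U` is itself in `U` (`mem_of_sub_smul_mem`), whence by induction
`ker (H - kπ)ⁿ ⊆ U × U` for all `n` (`kerPow_H_le`).
-/

open Set Filter Topology

/-! ### Absolutely continuous functions -/

/-- Absolute continuity passes to a function whose increments are dominated by those of an
absolutely continuous function. -/
theorem AbsolutelyContinuousOnInterval.of_dist_le {Y Z : Type*} [PseudoMetricSpace Y]
    [PseudoMetricSpace Z] {f : ℝ → Y} {g : ℝ → Z} {a b : ℝ}
    (hg : AbsolutelyContinuousOnInterval g a b)
    (h : ∀ x ∈ uIcc a b, ∀ y ∈ uIcc a b, dist (f x) (f y) ≤ dist (g x) (g y)) :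
    AbsolutelyContinuousOnInterval f a b := by
  rw [absolutelyContinuousOnInterval_iff] at hg ⊢
  intro ε hε
  obtain ⟨δ, hδ, H⟩ := hg ε hε
  refine ⟨δ, hδ, fun E hE hd => (Finset.sum_le_sum fun i hi => ?_).trans_lt (H E hE hd)⟩
  exact h _ (hE.1 i hi).1 _ (hE.1 i hi).2

theorem IntervalIntegrable.absolutelyContinuousOnInterval_integral {F : Type*}
    [NormedAddCommGroup F] [NormedSpace ℝ F] {h : ℝ → F} {a b : ℝ}
    (hh : IntervalIntegrable h volume a b) :
    AbsolutelyContinuousOnInterval (fun x => ∫ t in a..x, h t) a b := by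
  refine (hh.norm.absolutelyContinuousOnInterval_intervalIntegral
    (left_mem_uIcc (a := a) (b := b))).of_dist_le fun x hx y hy => ?_
  have hx' := hh.mono_set (uIcc_subset_uIcc left_mem_uIcc hx)
  have hy' := hh.mono_set (uIcc_subset_uIcc left_mem_uIcc hy)
  rw [dist_eq_norm, dist_eq_norm, intervalIntegral.integral_interval_sub_left hx' hy',
    intervalIntegral.integral_interval_sub_left hx'.norm hy'.norm]
  exact intervalIntegral.norm_integral_le_abs_integral_norm

/-- Fundamental theorem of calculus for absolutely continuous functions with values in a Banach
space, whose almost everywhere derivative is assumed to exist. -/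
theorem AbsolutelyContinuousOnInterval.integral_eq_sub_of_ae_hasDerivAt {F : Type*}
    [NormedAddCommGroup F] [NormedSpace ℝ F] [CompleteSpace F] {f h : ℝ → F} {a b : ℝ}
    (hf : AbsolutelyContinuousOnInterval f a b) (hh : IntervalIntegrable h volume a b)
    (hd : ∀ᵐ x, x ∈ uIcc a b → HasDerivAt f (h x) x) :
    ∫ x in a..b, h x = f b - f a := by
  have hd0 : ∀ᵐ x, x ∈ uIcc a b → HasDerivAt (f - fun x => ∫ t in a..x, h t) 0 x := by
    filter_upwards [hd, hh.ae_hasDerivAt_integral] with x h1 h2 hx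
    simpa using (h1 hx).sub (h2 hx a left_mem_uIcc)
  obtain ⟨C, hC⟩ :=
    (hf.sub hh.absolutelyContinuousOnInterval_integral).const_of_ae_hasDerivAt_zero hd0
  have ha := hC a left_mem_uIcc
  have hb := hC b right_mem_uIcc
  simp only [Pi.sub_apply, intervalIntegral.integral_same, sub_zero] at ha hb
  rw [ha, ← hb, sub_sub_cancel]

/-! ### The operator `T₀` and its adjoint -/

namespace PlateBending

/-- `f` is a representative of `p.1` that is absolutely continuous on `[0, 1]`, with derivative
`p.2` almost everywhere. -/
structure IsACRep (f : ℝ → ℂ) (p : L2 × L2) : Prop where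
  ac : AbsolutelyContinuousOnInterval f 0 1
  ae_eq : p.1 =ᵐ[volume.restrict (Ioo (0 : ℝ) 1)] f
  deriv : ∀ᵐ y ∂(volume.restrict (Ioo (0 : ℝ) 1)), HasDerivAt f (p.2 y) y

theorem ae_uIcc_of_ae_restrict {P : ℝ → Prop}
    (h : ∀ᵐ y ∂(volume.restrict (Ioo (0 : ℝ) 1)), P y) : ∀ᵐ y, y ∈ uIcc (0 : ℝ) 1 → P y := by
  rw [restrict_Ioo_eq_restrict_Icc] at h
  rw [uIcc_of_le zero_le_one]
  exact (ae_restrict_iff' measurableSet_Icc).1 h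

theorem intervalIntegrable_of_integrable {F : Type*} [NormedAddCommGroup F] {h : ℝ → F}
    (hh : Integrable h (volume.restrict (Ioo (0 : ℝ) 1))) : IntervalIntegrable h volume 0 1 := by
  rw [intervalIntegrable_iff_integrableOn_Ioo_of_le zero_le_one]
  exact hh

theorem intervalIntegral_eq_integral_restrict {F : Type*} [NormedAddCommGroup F]
    [NormedSpace ℝ F] (h : ℝ → F) :
    ∫ x in (0 : ℝ)..1, h x = ∫ x, h x ∂(volume.restrict (Ioo (0 : ℝ) 1)) := by
  rw [intervalIntegral.integral_of_le zero_le_one, integral_Ioc_eq_integral_Ioo]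

theorem exists_L2_ae_eq {f : ℝ → ℂ} (hf : ContinuousOn f (Icc 0 1)) :
    ∃ g : L2, g =ᵐ[volume.restrict (Ioo (0 : ℝ) 1)] f := by
  obtain ⟨C, hC⟩ := isCompact_Icc.exists_bound_of_continuousOn hf
  have hm : MemLp f 2 (volume.restrict (Ioo (0 : ℝ) 1)) := by
    refine MemLp.of_bound
      ((hf.mono Ioo_subset_Icc_self).aestronglyMeasurable measurableSet_Ioo) C ?_
    filter_upwards [ae_restrict_mem measurableSet_Ioo] with y hy
    exact hC y (Ioo_subset_Icc_self hy)
  exact ⟨hm.toLp f, hm.coeFn_toLp⟩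

theorem integrable_L2 (g : L2) : Integrable g (volume.restrict (Ioo (0 : ℝ) 1)) :=
  (Lp.memLp g).integrable one_le_two

theorem exists_isACRep_of_hasDerivAt {f f' : ℝ → ℂ} (hf : ∀ x, HasDerivAt f (f' x) x)
    (hf' : Continuous f') : ∃ p : L2 × L2, IsACRep f p ∧
      p.2 =ᵐ[volume.restrict (Ioo (0 : ℝ) 1)] f' := by
  have hd : deriv f = f' := funext fun x => (hf x).deriv
  have hc : ContDiff ℝ 1 f := contDiff_one_iff_deriv.2
    ⟨fun x => (hf x).differentiableAt, hd ▸ hf'⟩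
  obtain ⟨g, hg⟩ := exists_L2_ae_eq hc.continuous.continuousOn
  obtain ⟨h, hh⟩ := exists_L2_ae_eq hf'.continuousOn
  refine ⟨(g, h), ⟨hc.contDiffOn.absolutelyContinuousOnInterval, hg, ?_⟩, hh⟩
  filter_upwards [hh] with y hy
  rw [hy]
  exact hf y

/-- Integration by parts: the integrand is the derivative of `conj v * u`, which vanishes at both
endpoints. -/
theorem IsACRep.inner_add_inner {u v : ℝ → ℂ} {p q : L2 × L2} (hu : IsACRep u p)
    (hv : IsACRep v q) (h0 : u 0 = 0) (h1 : u 1 = 0) :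
    inner ℂ q.2 p.1 + inner ℂ q.1 p.2 = 0 := by
  have hvc : AbsolutelyContinuousOnInterval (fun x => star (v x)) 0 1 :=
    hv.ac.of_dist_le fun x _ y _ => (dist_star_star (v x) (v y)).le
  have hac := hvc.fun_smul hu.ac
  have hi : Integrable (fun x => inner ℂ (q.2 x) (p.1 x) + inner ℂ (q.1 x) (p.2 x))
      (volume.restrict (Ioo (0 : ℝ) 1)) :=
    (L2.integrable_inner q.2 p.1).add (L2.integrable_inner q.1 p.2)
  have key := hac.integral_eq_sub_of_ae_hasDerivAt (intervalIntegrable_of_integrable hi) (by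
    apply ae_uIcc_of_ae_restrict
    filter_upwards [hu.deriv, hv.deriv, hu.ae_eq, hv.ae_eq] with x h1 h2 h3 h4
    rw [h3, h4]
    refine (h2.star.smul h1).congr_deriv ?_
    simp only [RCLike.inner_apply, smul_eq_mul, starRingEnd_apply]
    ring)
  rw [intervalIntegral_eq_integral_restrict, integral_add (L2.integrable_inner q.2 p.1)
    (L2.integrable_inner q.1 p.2)] at key
  rw [L2.inner_def, L2.inner_def, key]
  simp [h0, h1]

theorem mem_T₀_graph_iff {p : L2 × L2} :
    p ∈ T₀.graph ↔ ∃ f, IsACRep f p ∧ f 0 = 0 ∧ f 1 = 0 := by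
  rw [T₀_graph]
  exact ⟨fun ⟨f, h1, h2, h3, h4, h5⟩ => ⟨f, ⟨h1, h4, h5⟩, h2, h3⟩,
    fun ⟨f, ⟨h1, h4, h5⟩, h2, h3⟩ => ⟨f, h1, h2, h3, h4, h5⟩⟩

/-- Test functions on `(0, 1)` belong to the domain, so a function orthogonal to the domain
vanishes almost everywhere. -/
theorem dense_T₀_domain : Dense (T₀.domain : Set L2) := by
  rw [Submodule.dense_iff_topologicalClosure_eq_top, Submodule.topologicalClosure_eq_top_iff,
    Submodule.eq_bot_iff]
  intro h hh
  rw [Submodule.mem_orthogonal'] at hh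
  have hz := isOpen_Ioo.ae_eq_zero_of_integral_contDiff_smul_eq_zero (μ := volume)
    (f := fun x => star (h x)) (U := Ioo (0 : ℝ) 1)
    (IntegrableOn.locallyIntegrableOn
      (Complex.conjCLE.toContinuousLinearMap.integrable_comp (integrable_L2 h))) ?_
  · rw [Lp.eq_zero_iff_ae_eq_zero]
    filter_upwards [(ae_restrict_iff' measurableSet_Ioo).2 hz] with x hx
    simpa using hx
  · intro g hg _ hsupp
    have hz : ∀ x, x ∉ Ioo (0 : ℝ) 1 → g x = 0 := fun x hx =>
      image_eq_zero_of_notMem_tsupport fun hx' => hx (hsupp hx')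
    have hd : ∀ x, HasDerivAt (fun y => (g y : ℂ)) ((deriv g x : ℝ) : ℂ) x := fun x =>
      ((hg.differentiable (by simp)) x).hasDerivAt.ofReal_comp
    obtain ⟨p, hp, -⟩ := exists_isACRep_of_hasDerivAt hd
      (Complex.continuous_ofReal.comp (hg.continuous_deriv (by simp)))
    have hmem : p ∈ T₀.graph :=
      mem_T₀_graph_iff.2 ⟨_, hp, by simp [hz 0], by simp [hz 1]⟩
    have := hh p.1 (LinearPMap.mem_domain_of_mem_graph hmem)
    rw [L2.inner_def] at this
    rw [← setIntegral_eq_integral_of_forall_compl_eq_zero (s := Ioo (0 : ℝ) 1)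
      (fun x hx => by simp [hz x hx]), ← this]
    refine integral_congr_ae ?_
    filter_upwards [hp.ae_eq] with x hx
    rw [hx]
    simp

/-- `T₀*` extends `-d/dx` on absolutely continuous functions, without boundary conditions. -/
theorem IsACRep.mem_T₀_adjoint_graph {v : ℝ → ℂ} {q : L2 × L2} (hv : IsACRep v q) :
    (q.1, -q.2) ∈ T₀.adjoint.graph := by
  have key : ∀ x : T₀.domain, inner ℂ (-q.2) (x : L2) = inner ℂ q.1 (T₀ x) := by
    intro x
    obtain ⟨u, hu, h0, h1⟩ := mem_T₀_graph_iff.1 (T₀.mem_graph x)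
    rw [inner_neg_left, neg_eq_iff_add_eq_zero]
    exact hu.inner_add_inner hv h0 h1
  have hd := LinearPMap.mem_adjoint_domain_of_exists q.1 ⟨_, key⟩
  rw [LinearPMap.mem_graph_iff]
  exact ⟨⟨q.1, hd⟩, rfl, LinearPMap.adjoint_apply_eq dense_T₀_domain ⟨q.1, hd⟩ key⟩

theorem dense_T₀_adjoint_domain : Dense (T₀.adjoint.domain : Set L2) := by
  refine dense_T₀_domain.mono fun x hx => ?_
  obtain ⟨u, hu, -, -⟩ := mem_T₀_graph_iff.1 (T₀.mem_graph ⟨x, hx⟩)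
  exact LinearPMap.mem_domain_of_mem_graph hu.mem_T₀_adjoint_graph

/-! ### Symmetric operators -/

section Symmetric

variable {E : Type*} [NormedAddCommGroup E] [InnerProductSpace ℂ E]

theorem _root_.LinearPMap.IsFormalAdjoint.eq_zero_of_surjective {S : E →ₗ.[ℂ] E}
    (hS : S.IsFormalAdjoint S) {z : ℂ}
    (hsurj : ∀ f, ∃ x : S.domain, S x - star z • (x : E) = f) (x : S.domain)
    (hx : S x - z • (x : E) = 0) : (x : E) = 0 := by
  obtain ⟨y, hy⟩ := hsurj x
  rw [← inner_self_eq_zero (𝕜 := ℂ)]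
  nth_rewrite 1 [← hy]
  rw [inner_sub_left, hS, inner_smul_left, starRingEnd_apply,
    star_star, ← inner_smul_right, ← inner_sub_right, hx, inner_zero_right]

/-- A symmetric operator `S` is self-adjoint as soon as `S - B` and `S - B*` are onto, where `B`
is everywhere defined: if `y ∈ D(S*)` and `(S* - B) y = (S - B) w`, then `y - w` is orthogonal to
the range of `S - B*`. -/
theorem adjoint_eq_self_of_surjective [CompleteSpace E] {S : E →ₗ.[ℂ] E}
    (hd : Dense (S.domain : Set E)) (hS : S.IsFormalAdjoint S) (B B' : E →ₗ[ℂ] E)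
    (hB : ∀ x y, inner ℂ (B' x) y = inner ℂ x (B y))
    (h : ∀ f, ∃ x : S.domain, S x - B x = f) (h' : ∀ f, ∃ x : S.domain, S x - B' x = f) :
    S.adjoint = S := by
  refine (LinearPMap.eq_of_le_of_domain_eq (hS.le_adjoint hd)
    (le_antisymm (hS.le_adjoint hd).1 fun y hy => ?_)).symm
  obtain ⟨w, hw⟩ := h (S.adjoint ⟨y, hy⟩ - B y)
  obtain ⟨v, hv⟩ := h' (y - w)
  have h1 : inner ℂ (S v) y = inner ℂ (v : E) (S.adjoint ⟨y, hy⟩) := by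
    rw [← inner_conj_symm, ← S.adjoint_isFormalAdjoint hd ⟨y, hy⟩ v, inner_conj_symm]
  have h2 : inner ℂ (y - w) (y - w) = 0 := by
    nth_rewrite 1 [← hv]
    simp only [inner_sub_left, inner_sub_right, hB, h1, hS v w]
    rw [← inner_sub_right, ← inner_sub_right, hw, sub_self]
  rw [inner_self_eq_zero, sub_eq_zero] at h2
  rw [h2]
  exact w.2

/-- The inverse of a symmetric operator minus a number is bounded once it is everywhere defined,
by the closed graph theorem. -/
theorem mem_resolventSet_of_surjective [CompleteSpace E] {S : E →ₗ.[ℂ] E}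
    (hS : S.IsFormalAdjoint S) {z : ℂ} (h : ∀ f, ∃ x : S.domain, S x - z • (x : E) = f)
    (h' : ∀ f, ∃ x : S.domain, S x - star z • (x : E) = f) : z ∈ resolventSet S := by
  choose R hR using h
  choose R' hR' using h'
  have huniq : ∀ x y : S.domain, S x - z • (x : E) = S y - z • (y : E) → x = y := by
    intro x y hxy
    rw [← sub_eq_zero, ← Subtype.coe_inj]
    refine hS.eq_zero_of_surjective (fun f => ⟨R' f, hR' f⟩) (x - y) ?_
    rw [S.map_sub, Submodule.coe_sub, smul_sub, sub_sub_sub_comm, hxy, sub_self]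
  have hadj : ∀ f g, inner ℂ (R f : E) g = inner ℂ f (R' g : E) := by
    intro f g
    conv_lhs => rw [← hR' g]
    conv_rhs => rw [← hR f]
    rw [inner_sub_left, inner_sub_right, hS, inner_smul_left, inner_smul_right]
    rfl
  let L : E →ₗ[ℂ] E :=
    { toFun := fun f => R f
      map_add' := fun f g => by
        rw [← Submodule.coe_add, Subtype.coe_inj]
        apply huniq
        rw [hR, S.map_add, Submodule.coe_add, smul_add, add_sub_add_comm, hR, hR]
      map_smul' := fun c f => by
        rw [RingHom.id_apply, ← Submodule.coe_smul, Subtype.coe_inj]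
        apply huniq
        rw [hR, S.map_smul, Submodule.coe_smul, smul_comm z c, ← smul_sub, hR] }
  refine ⟨ContinuousLinearMap.ofSeqClosedGraph (g := L) fun u x y hu hLu => ?_,
    fun f => ⟨(R f).2, hR f⟩, fun x => congrArg Subtype.val (huniq _ _ (hR _))⟩
  refine ext_inner_right ℂ fun g => ?_
  have h1 := hLu.inner (tendsto_const_nhds (x := g)) (𝕜 := ℂ)
  have h2 := hu.inner (tendsto_const_nhds (x := (R' g : E))) (𝕜 := ℂ)
  rw [show inner ℂ (L x) g = _ from hadj x g]
  exact tendsto_nhds_unique (h1.congr fun n => hadj (u n) g) h2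

/-- A finite-dimensional subspace `U` that is invariant under a symmetric operator and contains
`ker (S - r)` also contains `(S - r)⁻¹ U`: the component of a vector orthogonal to `U` is mapped
by `S - r` into `Uᗮ`. -/
theorem mem_of_sub_smul_mem {S : E →ₗ.[ℂ] E} (hS : S.IsFormalAdjoint S) (U : Submodule ℂ E)
    [FiniteDimensional ℂ U] (hU : ∀ x ∈ U, ∃ h : x ∈ S.domain, S ⟨x, h⟩ ∈ U) (r : ℝ)
    (hker : ∀ x : S.domain, S x - (r : ℂ) • (x : E) = 0 → (x : E) ∈ U) (y : S.domain)
    (hy : S y - (r : ℂ) • (y : E) ∈ U) : (y : E) ∈ U := by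
  obtain ⟨hp, hSp⟩ := hU _ (U.starProjection_apply_mem (y : E))
  set p : S.domain := ⟨U.starProjection y, hp⟩
  have hperp : ((y - p : S.domain) : E) ∈ Uᗮ := U.sub_starProjection_mem_orthogonal (y : E)
  have hmem : S (y - p) - (r : ℂ) • ((y - p : S.domain) : E) ∈ U := by
    rw [S.map_sub, Submodule.coe_sub, smul_sub, sub_sub_sub_comm]
    exact U.sub_mem hy (U.sub_mem hSp (U.smul_mem _ (U.starProjection_apply_mem (y : E))))
  have hmem' : S (y - p) - (r : ℂ) • ((y - p : S.domain) : E) ∈ Uᗮ := by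
    refine Submodule.sub_mem _ (fun u hu => ?_) (Submodule.smul_mem _ _ hperp)
    obtain ⟨hd, hSu⟩ := hU u hu
    rw [← hS ⟨u, hd⟩]
    exact hperp _ hSu
  have hz := hker _ (by
    rw [← Submodule.mem_bot ℂ, ← U.inf_orthogonal_eq_bot]
    exact ⟨hmem, hmem'⟩)
  simpa [p] using U.add_mem hz (U.starProjection_apply_mem (y : E))

end Symmetric

/-! ### Density of block domains -/

section Block

variable {X₁ X₂ : Type*}
  [NormedAddCommGroup X₁] [InnerProductSpace ℂ X₁]
  [NormedAddCommGroup X₂] [InnerProductSpace ℂ X₂]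

theorem dense_blockDomain {A : X₁ →ₗ.[ℂ] X₁} {B : X₂ →ₗ.[ℂ] X₁} {C : X₁ →ₗ.[ℂ] X₂}
    {D : X₂ →ₗ.[ℂ] X₂} (h₁ : Dense ((A.domain ⊓ C.domain : Submodule ℂ X₁) : Set X₁))
    (h₂ : Dense ((B.domain ⊓ D.domain : Submodule ℂ X₂) : Set X₂)) :
    Dense ((blockOperator A B C D).domain : Set (WithLp 2 (X₁ × X₂))) :=
  (h₁.prod h₂).preimage (WithLp.homeomorphProd 2 X₁ X₂).isOpenMap

end Block

/-! ### The operator `A`: symmetry, range and kernel of `A - z` -/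

theorem A_domain_mem_iff {x : X} :
    x ∈ A.domain ↔ x.fst ∈ T₀.domain ∧ x.snd ∈ T₀.adjoint.domain :=
  ⟨fun h => ⟨h.1.2, h.2.1⟩, fun h => ⟨⟨trivial, h.1⟩, h.2, trivial⟩⟩

theorem A_apply (x : A.domain) : A x = WithLp.toLp 2
    (T₀.adjoint ⟨(x : X).snd, (A_domain_mem_iff.1 x.2).2⟩,
      T₀ ⟨(x : X).fst, (A_domain_mem_iff.1 x.2).1⟩) := by
  refine WithLp.ofLp_injective 2 (Prod.ext (zero_add _) (add_zero _))

theorem isFormalAdjoint_A : A.IsFormalAdjoint A := by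
  intro x y
  have h := T₀.adjoint_isFormalAdjoint dense_T₀_domain
  rw [A_apply, A_apply, WithLp.prod_inner_apply, WithLp.prod_inner_apply]
  rw [add_comm]
  exact congrArg₂ (· + ·)
    (h.symm ⟨(x : X).fst, (A_domain_mem_iff.1 x.2).1⟩ ⟨(y : X).snd, (A_domain_mem_iff.1 y.2).2⟩)
    (h ⟨(x : X).snd, (A_domain_mem_iff.1 x.2).2⟩ ⟨(y : X).fst, (A_domain_mem_iff.1 y.2).1⟩)

theorem dense_A_domain : Dense (A.domain : Set X) := by
  refine dense_blockDomain (dense_T₀_domain.mono fun x hx => ⟨trivial, hx⟩)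
    (dense_T₀_adjoint_domain.mono fun x hx => ⟨hx, trivial⟩)

/-- Boundary value problem: absolutely continuous representatives that solve
`-v' = f`, `u' = g` with `u(0) = u(1) = 0` give a solution of `A (u, v) = (f, g)`. -/
theorem exists_A_apply_eq {u v : ℝ → ℂ} {p q : L2 × L2} (hu : IsACRep u p) (hv : IsACRep v q)
    (h0 : u 0 = 0) (h1 : u 1 = 0) :
    ∃ h : WithLp.toLp 2 (p.1, q.1) ∈ A.domain,
      A ⟨WithLp.toLp 2 (p.1, q.1), h⟩ = WithLp.toLp 2 (-q.2, p.2) := by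
  obtain ⟨⟨x, hx⟩, hx1, hx2⟩ :=
    LinearPMap.mem_graph_iff _ |>.1 (mem_T₀_graph_iff.2 ⟨u, hu, h0, h1⟩)
  obtain ⟨⟨y, hy⟩, hy1, hy2⟩ := LinearPMap.mem_graph_iff _ |>.1 hv.mem_T₀_adjoint_graph
  dsimp only at hx1 hx2 hy1 hy2
  subst hx1 hy1
  refine ⟨A_domain_mem_iff.2 ⟨hx, hy⟩, ?_⟩
  rw [A_apply, ← hx2, ← hy2]
  rfl

theorem intervalIntegrable_exp_mul (w s : ℂ) (a b : L2) : IntervalIntegrable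
    (fun t : ℝ => Complex.exp (w * t) * (b t + s * a t)) volume 0 1 :=
  ((intervalIntegrable_of_integrable (integrable_L2 b)).add
    ((intervalIntegrable_of_integrable (integrable_L2 a)).const_mul s)).continuousOn_mul
      (by fun_prop)

/-- Variation of constants: in terms of `w± = u ± i v` the equation `(A - z)(u, v) = (a, b)` reads
`w±' = ∓ i z w± + (b ∓ i a)`. With `w±(0) = ± c` the condition `u(0) = 0` holds, and the hypothesis
on `c` is the condition `u(1) = 0`. -/
theorem exists_A_sub_smul_eq (z c : ℂ) (f : X)
    (hc : Complex.exp (-(z * Complex.I)) * (c + ∫ t in (0 : ℝ)..1,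
          Complex.exp (z * Complex.I * t) * (f.snd t - Complex.I * f.fst t)) +
        Complex.exp (z * Complex.I) * (-c + ∫ t in (0 : ℝ)..1,
          Complex.exp (-(z * Complex.I) * t) * (f.snd t + Complex.I * f.fst t)) = 0) :
    ∃ x : A.domain, A x - z • (x : X) = f := by
  set a := f.fst
  set b := f.snd
  have hexp : ∀ (w : ℂ) (x : ℝ), HasDerivAt (fun t : ℝ => Complex.exp (w * t))
      (w * Complex.exp (w * x)) x := by
    intro w x
    refine (((hasDerivAt_id (x : ℂ)).const_mul w).cexp.comp_ofReal).congr_deriv ?_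
    simp [mul_comm]
  have hac : ∀ w : ℂ, AbsolutelyContinuousOnInterval (fun t : ℝ => Complex.exp (w * t)) 0 1 := by
    intro w
    refine ContDiffOn.absolutelyContinuousOnInterval (ContDiff.contDiffOn ?_)
    exact (contDiff_const.mul Complex.ofRealCLM.contDiff).cexp
  have hpi : IntervalIntegrable
      (fun t : ℝ => Complex.exp (z * Complex.I * t) * (b t - Complex.I * a t)) volume 0 1 := by
    simpa [sub_eq_add_neg] using intervalIntegrable_exp_mul (z * Complex.I) (-Complex.I) a b
  have hqi : IntervalIntegrable
      (fun t : ℝ => Complex.exp (-(z * Complex.I) * t) * (b t + Complex.I * a t)) volume 0 1 :=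
    intervalIntegrable_exp_mul _ _ a b
  let P : ℝ → ℂ := fun x => c + ∫ t in (0 : ℝ)..x,
    Complex.exp (z * Complex.I * t) * (b t - Complex.I * a t)
  let Q : ℝ → ℂ := fun x => -c + ∫ t in (0 : ℝ)..x,
    Complex.exp (-(z * Complex.I) * t) * (b t + Complex.I * a t)
  have hconst : ∀ k : ℂ, AbsolutelyContinuousOnInterval (fun _ : ℝ => k) 0 1 := fun k =>
    contDiff_const.contDiffOn.absolutelyContinuousOnInterval
  have hP : AbsolutelyContinuousOnInterval P 0 1 :=
    (hconst c).fun_add hpi.absolutelyContinuousOnInterval_integral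
  have hQ : AbsolutelyContinuousOnInterval Q 0 1 :=
    (hconst (-c)).fun_add hqi.absolutelyContinuousOnInterval_integral
  let u : ℝ → ℂ := fun x => (2⁻¹ : ℂ) • (Complex.exp (-(z * Complex.I) * x) • P x +
    Complex.exp (z * Complex.I * x) • Q x)
  let v : ℝ → ℂ := fun x => (-(Complex.I / 2) : ℂ) • (Complex.exp (-(z * Complex.I) * x) • P x -
    Complex.exp (z * Complex.I * x) • Q x)
  have hu : AbsolutelyContinuousOnInterval u 0 1 :=
    (((hac _).fun_smul hP).fun_add ((hac _).fun_smul hQ)).const_smul _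
  have hv : AbsolutelyContinuousOnInterval v 0 1 :=
    (((hac _).fun_smul hP).fun_sub ((hac _).fun_smul hQ)).const_smul _
  obtain ⟨U, hU⟩ := exists_L2_ae_eq (f := u) (by
    simpa [uIcc_of_le (zero_le_one (α := ℝ))] using hu.continuousOn)
  obtain ⟨V, hV⟩ := exists_L2_ae_eq (f := v) (by
    simpa [uIcc_of_le (zero_le_one (α := ℝ))] using hv.continuousOn)
  have hPd : ∀ᵐ x : ℝ ∂(volume.restrict (Ioo (0 : ℝ) 1)), HasDerivAt P
      (Complex.exp (z * Complex.I * x) * (b x - Complex.I * a x)) x := by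
    rw [ae_restrict_iff' measurableSet_Ioo]
    filter_upwards [hpi.ae_hasDerivAt_integral] with x hx hx'
    exact (hx (by rw [uIcc_of_le zero_le_one]; exact Ioo_subset_Icc_self hx') 0
      left_mem_uIcc).const_add c
  have hQd : ∀ᵐ x : ℝ ∂(volume.restrict (Ioo (0 : ℝ) 1)), HasDerivAt Q
      (Complex.exp (-(z * Complex.I) * x) * (b x + Complex.I * a x)) x := by
    rw [ae_restrict_iff' measurableSet_Ioo]
    filter_upwards [hqi.ae_hasDerivAt_integral] with x hx hx'
    exact (hx (by rw [uIcc_of_le zero_le_one]; exact Ioo_subset_Icc_self hx') 0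
      left_mem_uIcc).const_add (-c)
  -- `e^{∓ i z x} e^{± i z x} = 1` turns the inhomogeneous terms of `w±'` into `b ∓ i a`.
  have hinv : ∀ x : ℝ, Complex.exp (-(z * Complex.I) * x) * Complex.exp (z * Complex.I * x) = 1 :=
    fun x => by rw [← Complex.exp_add, neg_mul, neg_add_cancel, Complex.exp_zero]
  have hUrep : IsACRep u (U, z • V + b) := by
    refine ⟨hu, hU, ?_⟩
    filter_upwards [hPd, hQd, hV, Lp.coeFn_add (z • V) b, Lp.coeFn_smul z V] with x h1 h2 h3 h4 h5
    refine ((((hexp _ x).smul h1).add ((hexp _ x).smul h2)).const_smul (2⁻¹ : ℂ)).congr_deriv ?_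
    rw [h4, Pi.add_apply, h5, Pi.smul_apply, h3]
    simp only [v, smul_eq_mul]
    linear_combination (b x) * hinv x
  have hVrep : IsACRep v (V, -(z • U + a)) := by
    refine ⟨hv, hV, ?_⟩
    filter_upwards [hPd, hQd, hU, Lp.coeFn_neg (z • U + a), Lp.coeFn_add (z • U) a,
      Lp.coeFn_smul z U] with x h1 h2 h3 h4 h5 h6
    refine ((((hexp _ x).smul h1).sub ((hexp _ x).smul h2)).const_smul
      (-(Complex.I / 2) : ℂ)).congr_deriv ?_
    rw [h4, Pi.neg_apply, h5, Pi.add_apply, h6, Pi.smul_apply, h3]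
    simp only [u, smul_eq_mul]
    linear_combination (-(a x)) * hinv x +
      ((2⁻¹ : ℂ) * z * (Complex.exp (-(z * Complex.I) * x) * P x +
        Complex.exp (z * Complex.I * x) * Q x) + a x *
        (Complex.exp (-(z * Complex.I) * x) * Complex.exp (z * Complex.I * x))) *
        Complex.I_mul_I
  have hu0 : u 0 = 0 := by simp [u, P, Q]
  have hu1 : u 1 = 0 := by
    simp only [u, P, Q, Complex.ofReal_one, mul_one, smul_eq_mul]
    rw [hc, mul_zero]
  obtain ⟨hd, hA⟩ := exists_A_apply_eq hUrep hVrep hu0 hu1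
  refine ⟨⟨_, hd⟩, ?_⟩
  rw [hA]
  refine WithLp.ofLp_injective 2 (Prod.ext ?_ ?_)
  · change -(-(z • U + a)) - z • U = a
    abel
  · change z • V + b - z • V = b
    abel

/-- The set `πℤ` of integer multiples of `π`, as complex numbers. -/
def piMultiples : Set ℂ := {z : ℂ | ∃ k : ℤ, z = (k : ℂ) * (Real.pi : ℂ)}

theorem neg_mem_piMultiples {z : ℂ} (hz : z ∈ piMultiples) : -z ∈ piMultiples := by
  obtain ⟨k, rfl⟩ := hz
  exact ⟨-k, by simp⟩

theorem star_mem_piMultiples {z : ℂ} (hz : z ∈ piMultiples) : star z ∈ piMultiples := by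
  obtain ⟨k, rfl⟩ := hz
  exact ⟨k, by simp⟩

/-- For `z ∉ πℤ` the condition `u(1) = 0` is a linear equation for the constant `c` with leading
coefficient `e^{-iz} - e^{iz} ≠ 0`. -/
theorem A_sub_smul_surjective {z : ℂ} (hz : z ∉ piMultiples) (f : X) :
    ∃ x : A.domain, A x - z • (x : X) = f := by
  have hne : Complex.exp (-(z * Complex.I)) - Complex.exp (z * Complex.I) ≠ 0 := by
    intro h
    refine hz (Complex.sin_eq_zero_iff.1 ?_)
    rw [Complex.sin, neg_mul, h, zero_mul, zero_div]
  set I₁ := ∫ t in (0 : ℝ)..1,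
    Complex.exp (z * Complex.I * t) * (f.snd t - Complex.I * f.fst t)
  set I₂ := ∫ t in (0 : ℝ)..1,
    Complex.exp (-(z * Complex.I) * t) * (f.snd t + Complex.I * f.fst t)
  refine exists_A_sub_smul_eq z (-(Complex.exp (-(z * Complex.I)) * I₁ +
    Complex.exp (z * Complex.I) * I₂) /
      (Complex.exp (-(z * Complex.I)) - Complex.exp (z * Complex.I))) f ?_
  change Complex.exp (-(z * Complex.I)) * (_ + I₁) + Complex.exp (z * Complex.I) * (-_ + I₂) = 0
  field_simp
  ring

/-- The eigenvector `(sin kπx, cos kπx)` of `A`. -/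
theorem exists_A_eigenvector (k : ℤ) : ∃ x : A.domain, A x = ((k * Real.pi : ℝ) : ℂ) • (x : X) ∧
    (x : X).fst =ᵐ[volume.restrict (Ioo (0 : ℝ) 1)]
      (fun t => ((Real.sin (k * Real.pi * t) : ℝ) : ℂ)) ∧
    (x : X).snd =ᵐ[volume.restrict (Ioo (0 : ℝ) 1)]
      (fun t => ((Real.cos (k * Real.pi * t) : ℝ) : ℂ)) := by
  set r : ℝ := k * Real.pi
  have hr : ∀ x : ℝ, HasDerivAt (fun t => r * t) r x := fun x => by
    simpa using (hasDerivAt_id x).const_mul r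
  obtain ⟨p, hp, hp'⟩ := exists_isACRep_of_hasDerivAt
    (fun x => ((Real.hasDerivAt_sin (r * x)).comp x (hr x)).ofReal_comp) (by fun_prop)
  obtain ⟨q, hq, hq'⟩ := exists_isACRep_of_hasDerivAt
    (fun x => ((Real.hasDerivAt_cos (r * x)).comp x (hr x)).ofReal_comp) (by fun_prop)
  obtain ⟨hd, hA⟩ := exists_A_apply_eq hp hq (by simp) (by simp [r, Real.sin_int_mul_pi])
  refine ⟨⟨_, hd⟩, ?_, hp.ae_eq, hq.ae_eq⟩
  rw [hA]
  refine WithLp.ofLp_injective 2 (Prod.ext (Lp.ext ?_) (Lp.ext ?_))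
  · change (-q.2 : L2) =ᵐ[_] ((r : ℂ) • p.1 : L2)
    filter_upwards [Lp.coeFn_neg q.2, Lp.coeFn_smul (r : ℂ) p.1, hp.ae_eq, hq'] with x h1 h2 h3 h4
    rw [h1, h2, Pi.neg_apply, Pi.smul_apply, h3, h4]
    simp [mul_comm]
  · change (p.2 : L2) =ᵐ[_] ((r : ℂ) • q.1 : L2)
    filter_upwards [Lp.coeFn_smul (r : ℂ) q.1, hq.ae_eq, hp'] with x h1 h2 h3
    rw [h1, Pi.smul_apply, h2, h3]
    simp [mul_comm]

/-- The eigenspaces of `A` are finite-dimensional. By variation of constants every vector orthogonal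
to the eigenvector `(sin kπx, cos kπx)` is in the range of `A - kπ`, so `ker (A - kπ)`, which is
orthogonal to that range, is spanned by the eigenvector. -/
theorem exists_span_A_eigenvector (k : ℤ) : ∃ x : A.domain, (x : X) ≠ 0 ∧
    A x = ((k * Real.pi : ℝ) : ℂ) • (x : X) ∧
    ∀ y : A.domain, A y - ((k * Real.pi : ℝ) : ℂ) • (y : X) = 0 →
      (y : X) ∈ Submodule.span ℂ {(x : X)} := by
  obtain ⟨x, hx, hx1, hx2⟩ := exists_A_eigenvector k
  refine ⟨x, ?_, hx, fun y hy => ?_⟩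
  · -- `sin` and `cos` have no common zero.
    intro h0
    have h1 : (x : X).fst = 0 := by rw [h0]; rfl
    have h2 : (x : X).snd = 0 := by rw [h0]; rfl
    rw [h1] at hx1
    rw [h2] at hx2
    have hF : ∀ᵐ t ∂(volume.restrict (Ioo (0 : ℝ) 1)), False := by
      filter_upwards [hx1, hx2, Lp.coeFn_zero ℂ 2 (volume.restrict (Ioo (0 : ℝ) 1))]
        with t h3 h4 h5
      rw [h5, Pi.zero_apply, eq_comm, Complex.ofReal_eq_zero] at h3 h4
      simpa [h3, h4] using Real.sin_sq_add_cos_sq (k * Real.pi * t)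
    have h6 := ae_iff.1 hF
    simp at h6
  · rw [← Submodule.orthogonal_orthogonal (Submodule.span ℂ {(x : X)})]
    intro f hf
    rw [Submodule.mem_orthogonal_singleton_iff_inner_right] at hf
    suffices h : ∃ w : A.domain, A w - ((k * Real.pi : ℝ) : ℂ) • (w : X) = f by
      obtain ⟨w, rfl⟩ := h
      rw [inner_sub_left, isFormalAdjoint_A, inner_smul_left, Complex.conj_ofReal,
        ← inner_smul_right, ← inner_sub_right, hy, inner_zero_right]
    -- As `e^{-ikπ} = e^{ikπ}`, the constant drops out of the condition `u(1) = 0`, and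
    -- the two integrals add up to twice the inner product of the eigenvector with `f`.
    refine exists_A_sub_smul_eq _ 0 f ?_
    set r : ℝ := k * Real.pi
    have he : Complex.exp (-(r * Complex.I)) = Complex.exp (r * Complex.I) := by
      have : Complex.sin r = 0 := by
        rw [← Complex.ofReal_sin, Real.sin_int_mul_pi, Complex.ofReal_zero]
      rw [← neg_mul, Complex.exp_mul_I, Complex.exp_mul_I, Complex.cos_neg, Complex.sin_neg, this,
        neg_zero]
    have hp : IntervalIntegrable (fun t : ℝ => Complex.exp (r * Complex.I * t) *
        (f.snd t - Complex.I * f.fst t)) volume 0 1 := by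
      simpa [sub_eq_add_neg] using
        intervalIntegrable_exp_mul (r * Complex.I) (-Complex.I) f.fst f.snd
    rw [he, ← mul_add, zero_add, neg_zero, zero_add,
      ← intervalIntegral.integral_add hp (intervalIntegrable_exp_mul _ _ _ _),
      intervalIntegral_eq_integral_restrict]
    rw [WithLp.prod_inner_apply, L2.inner_def, L2.inner_def,
      ← integral_add (L2.integrable_inner _ _) (L2.integrable_inner _ _)] at hf
    refine mul_eq_zero_of_right _ (Eq.trans ?_ (mul_eq_zero_of_right (2 : ℂ) hf))
    rw [← integral_const_mul]
    refine integral_congr_ae ?_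
    filter_upwards [hx1, hx2] with t h1 h2
    change _ = 2 * (inner ℂ ((x : X).fst t) (f.fst t) + inner ℂ ((x : X).snd t) (f.snd t))
    have e1 : (r : ℂ) * Complex.I * t = ((r * t : ℝ) : ℂ) * Complex.I := by push_cast; ring
    have e2 : -((r : ℂ) * Complex.I) * t = -((r * t : ℝ) : ℂ) * Complex.I := by push_cast; ring
    rw [h1, h2, e1, e2, Complex.exp_mul_I, Complex.exp_mul_I, Complex.cos_neg, Complex.sin_neg,
      RCLike.inner_apply, RCLike.inner_apply, Complex.conj_ofReal, Complex.conj_ofReal,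
      Complex.ofReal_sin, Complex.ofReal_cos]
    linear_combination (-2 * Complex.sin ((r * t : ℝ) : ℂ) * f.fst t) * Complex.I_mul_I

/-! ### The Hamiltonian operator matrix `H` -/

theorem isSelfAdjoint_zero : IsSelfAdjoint (0 : X →ₗ.[ℂ] X) :=
  adjoint_eq_self_of_surjective dense_univ
    (fun x y => by rw [LinearPMap.zero_apply, LinearPMap.zero_apply, inner_zero_left,
      inner_zero_right]) LinearMap.id LinearMap.id (fun _ _ => rfl)
    (fun f => ⟨⟨-f, trivial⟩, by simp [LinearPMap.zero_apply]⟩)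
    (fun f => ⟨⟨-f, trivial⟩, by simp [LinearPMap.zero_apply]⟩)

theorem one_notMem_piMultiples : (1 : ℂ) ∉ piMultiples := by
  rintro ⟨k, hk⟩
  have h : (1 : ℝ) = k * Real.pi := by exact_mod_cast hk
  have h3 := Real.pi_gt_three
  rcases le_or_gt k 0 with h0 | h0
  · have : (k : ℝ) ≤ 0 := by exact_mod_cast h0
    nlinarith
  · have : (1 : ℝ) ≤ k := by exact_mod_cast h0
    nlinarith

theorem isSelfAdjoint_A : IsSelfAdjoint A :=
  adjoint_eq_self_of_surjective dense_A_domain isFormalAdjoint_A LinearMap.id LinearMap.id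
    (fun _ _ => rfl)
    (fun f => by simpa using A_sub_smul_surjective one_notMem_piMultiples f)
    (fun f => by simpa using A_sub_smul_surjective one_notMem_piMultiples f)

theorem A_add_one_apply (x : (A + one).domain) : (A + one) x = A ⟨x, x.2.1⟩ + (x : X) := rfl

theorem dense_A_add_one_domain : Dense ((A + one).domain : Set X) :=
  dense_A_domain.mono fun _ hx => ⟨hx, trivial⟩

theorem isSelfAdjoint_A_add_one : IsSelfAdjoint (A + one) := by
  have h : ∀ f, ∃ x : (A + one).domain,
      (A + one) x - ((2 : ℂ) • LinearMap.id : X →ₗ[ℂ] X) (x : X) = f := by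
    intro f
    obtain ⟨x, hx⟩ := A_sub_smul_surjective one_notMem_piMultiples f
    refine ⟨⟨x, x.2, trivial⟩, ?_⟩
    rw [A_add_one_apply, ← hx, LinearMap.smul_apply, LinearMap.id_apply]
    module
  refine adjoint_eq_self_of_surjective dense_A_add_one_domain (fun x y => ?_)
    ((2 : ℂ) • LinearMap.id) ((2 : ℂ) • LinearMap.id) (fun x y => ?_) h h
  · rw [A_add_one_apply, A_add_one_apply, inner_add_left, inner_add_right,
      isFormalAdjoint_A ⟨x, x.2.1⟩ ⟨y, y.2.1⟩]
  · simp [mul_comm]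

theorem dense_H_domain : Dense (H.domain : Set (WithLp 2 (X × X))) :=
  dense_blockDomain (dense_A_domain.mono fun _ hx => ⟨hx, trivial⟩)
    (dense_A_domain.mono fun _ hx => ⟨⟨hx, trivial⟩, hx⟩)

theorem isHamiltonian_H : IsHamiltonian A (A + one) 0 (-A) where
  closed_A := isSelfAdjoint_A.isClosed
  closed_B := isSelfAdjoint_A_add_one.isClosed
  closed_C := isSelfAdjoint_zero.isClosed
  dense_A := dense_A_domain
  dense_B := dense_A_add_one_domain
  dense_C := dense_univ
  selfAdjoint_B := isSelfAdjoint_A_add_one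
  selfAdjoint_C := isSelfAdjoint_zero
  eq_neg_adjoint := congrArg Neg.neg isSelfAdjoint_A.symm
  dense_block := dense_H_domain

theorem H_domain_mem_iff {x : WithLp 2 (X × X)} :
    x ∈ H.domain ↔ x.fst ∈ A.domain ∧ x.snd ∈ A.domain :=
  ⟨fun h => ⟨h.1.1, h.2.2⟩, fun h => ⟨⟨h.1, trivial⟩, ⟨h.2, trivial⟩, h.2⟩⟩

/-- The value of `H` at a pair; together with `exists_of_H_domain` it hides the intersections in the
block domain of `H`. -/
theorem H_apply (x y : A.domain) (h : WithLp.toLp 2 ((x : X), (y : X)) ∈ H.domain) :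
    H ⟨WithLp.toLp 2 ((x : X), (y : X)), h⟩ = WithLp.toLp 2 (A x + (A y + y), -A y) :=
  WithLp.ofLp_injective 2 (Prod.ext rfl (zero_add _))

theorem exists_of_H_domain (x : H.domain) : ∃ (y z : A.domain)
    (h : WithLp.toLp 2 ((y : X), (z : X)) ∈ H.domain),
    x = ⟨WithLp.toLp 2 ((y : X), (z : X)), h⟩ :=
  ⟨⟨_, (H_domain_mem_iff.1 x.2).1⟩, ⟨_, (H_domain_mem_iff.1 x.2).2⟩, x.2, rfl⟩

theorem toLp_mem_H_domain (x y : A.domain) : WithLp.toLp 2 ((x : X), (y : X)) ∈ H.domain :=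
  H_domain_mem_iff.2 ⟨x.2, y.2⟩

/-- `H - z` is inverted by back substitution, using the bounded inverses `R` of `A - z` and `R'`
of `A + z`. -/
theorem mem_resolventSet_H {z : ℂ} (hz : z ∉ piMultiples) : z ∈ resolventSet H := by
  have hmem : ∀ w ∉ piMultiples, w ∈ resolventSet A := fun w hw =>
    mem_resolventSet_of_surjective isFormalAdjoint_A (A_sub_smul_surjective hw)
      (A_sub_smul_surjective fun h => hw (by simpa using star_mem_piMultiples h))
  obtain ⟨R, hR, hR2⟩ := hmem z hz
  obtain ⟨R', hR', hR2'⟩ := hmem (-z) fun h => hz (by simpa using neg_mem_piMultiples h)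
  choose hRd hR using hR
  choose hRd' hR' using hR'
  -- The solution of `(H - z) (x, y) = f` is `y = -R' f₂` and `x = R (f₁ + f₂ - (1 - z) y)`, because
  -- `(A + 1) y = -f₂ + (1 - z) y`.
  let F := WithLp.fstL 2 ℂ X X
  let G := WithLp.sndL 2 ℂ X X
  let L : WithLp 2 (X × X) →L[ℂ] WithLp 2 (X × X) :=
    ((WithLp.prodContinuousLinearEquiv 2 ℂ X X).symm : X × X →L[ℂ] WithLp 2 (X × X)).comp
      ((R.comp (F + G + (1 - z) • R'.comp G)).prod (-R'.comp G))
  have hL : ∀ f, L f = WithLp.toLp 2 (R (f.fst + f.snd + (1 - z) • R' f.snd), -R' f.snd) :=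
    fun f => rfl
  refine ⟨L, fun f => ⟨?_, ?_⟩, fun x => ?_⟩
  · rw [hL]
    exact toLp_mem_H_domain ⟨_, hRd _⟩ (-⟨_, hRd' _⟩)
  · have h1 := hR (f.fst + f.snd + (1 - z) • R' f.snd)
    have h2 := hR' f.snd
    set p : A.domain := ⟨_, hRd (f.fst + f.snd + (1 - z) • R' f.snd)⟩
    set q : A.domain := ⟨_, hRd' f.snd⟩
    refine (congrArg (· - z • L f) (H_apply p (-q) (toLp_mem_H_domain p (-q)))).trans ?_
    rw [hL]
    refine WithLp.ofLp_injective 2 (Prod.ext ?_ ?_)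
    · change A p + (A (-q) + -(q : X)) - z • (p : X) = f.fst
      rw [A.map_neg]
      rw [sub_eq_iff_eq_add] at h1 h2
      rw [h1, h2]
      change f.fst + f.snd + (1 - z) • (q : X) + z • (p : X) + (-(f.snd + -z • (q : X)) + -(q : X))
        - z • (p : X) = f.fst
      module
    · change -A (-q) - z • -(q : X) = f.snd
      rw [A.map_neg]
      rw [sub_eq_iff_eq_add] at h2
      rw [h2]
      change - -(f.snd + -z • (q : X)) - z • -(q : X) = f.snd
      module
  · obtain ⟨p, q, h, rfl⟩ := exists_of_H_domain x
    rw [H_apply, hL]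
    refine WithLp.ofLp_injective 2 (Prod.ext ?_ ?_)
    · change R (A p + (A q + q) - z • (p : X) + (-A q - z • (q : X)) +
        (1 - z) • R' (-A q - z • (q : X))) = p
      have e1 : -A q - z • (q : X) = -(A q - -z • (q : X)) := by module
      rw [e1, map_neg, hR2']
      refine (congrArg R ?_).trans (hR2 p)
      module
    · change -R' (-A q - z • (q : X)) = q
      have e1 : -A q - z • (q : X) = -(A q - -z • (q : X)) := by module
      rw [e1, map_neg, hR2', neg_neg]

/-- `J H` is self-adjoint: it is symmetric, and `J H - z J = J (H - z)` is onto for `z ∉ πℤ`, in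
particular for `z = ±1`, where `J* = -J`. -/
theorem symplecticUnit_compPMap_H_adjoint :
    ((symplecticUnit X).compPMap H).adjoint = (symplecticUnit X).compPMap H := by
  have hJ : ∀ x : WithLp 2 (X × X), symplecticUnit X x = WithLp.toLp 2 (x.snd, -x.fst) :=
    fun x => rfl
  have hsurj : ∀ z ∉ piMultiples, ∀ f, ∃ x : ((symplecticUnit X).compPMap H).domain,
      (symplecticUnit X).compPMap H x -
        (z • symplecticUnit X) (x : WithLp 2 (X × X)) = f := by
    intro z hz f
    obtain ⟨R, hR, -⟩ := mem_resolventSet_H hz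
    obtain ⟨h, hR⟩ := hR (WithLp.toLp 2 (-f.snd, f.fst))
    refine ⟨⟨_, h⟩, ?_⟩
    change symplecticUnit X (H ⟨_, h⟩) - z • symplecticUnit X _ = f
    rw [← map_smul, ← map_sub, hR, hJ]
    exact WithLp.ofLp_injective 2 (Prod.ext rfl (neg_neg f.snd))
  refine adjoint_eq_self_of_surjective dense_H_domain (fun x y => ?_)
    ((1 : ℂ) • symplecticUnit X) ((-1 : ℂ) • symplecticUnit X) (fun x y => ?_)
    (hsurj 1 one_notMem_piMultiples)
    (hsurj (-1) fun h => one_notMem_piMultiples (by simpa using neg_mem_piMultiples h))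
  · obtain ⟨p, q, h, rfl⟩ := exists_of_H_domain x
    obtain ⟨p', q', h', rfl⟩ := exists_of_H_domain y
    change inner ℂ (symplecticUnit X (H ⟨_, h⟩)) _ = inner ℂ _ (symplecticUnit X (H ⟨_, h'⟩))
    rw [H_apply, H_apply, hJ, hJ, WithLp.prod_inner_apply, WithLp.prod_inner_apply]
    change inner ℂ (-A q) (p' : X) + inner ℂ (-(A p + (A q + q))) (q' : X) =
      inner ℂ (p : X) (-A q') + inner ℂ (q : X) (-(A p' + (A q' + q')))
    simp only [inner_neg_left, inner_neg_right, inner_add_left, inner_add_right,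
      isFormalAdjoint_A q p', isFormalAdjoint_A p q', isFormalAdjoint_A q q']
    ring
  · rw [LinearMap.smul_apply, LinearMap.smul_apply, hJ, hJ, one_smul, neg_one_smul,
      WithLp.prod_inner_apply, WithLp.prod_inner_apply]
    change inner ℂ (-x.snd) y.fst + inner ℂ (- -x.fst) y.snd =
      inner ℂ x.fst y.snd + inner ℂ x.snd (-y.fst)
    rw [neg_neg, inner_neg_left, inner_neg_right, add_comm]

/-! ### Spectrum and root subspaces of `H` -/

theorem pointSpectrum_subset_spectrumSet {Y : Type*} [NormedAddCommGroup Y] [NormedSpace ℂ Y]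
    (T : Y →ₗ.[ℂ] Y) : pointSpectrum T ⊆ spectrumSet T := by
  rintro z ⟨x, hx0, hx⟩ ⟨R, -, hR⟩
  refine hx0 ?_
  rw [← hR x, hx, sub_self, map_zero]

theorem spectrumSet_H_subset : spectrumSet H ⊆ piMultiples := fun _ hz => by
  by_contra h
  exact hz (mem_resolventSet_H h)

theorem piMultiples_subset_pointSpectrum_H : piMultiples ⊆ pointSpectrum H := by
  rintro z ⟨k, rfl⟩
  obtain ⟨x, hx0, hx, -⟩ := exists_span_A_eigenvector k
  refine ⟨⟨_, toLp_mem_H_domain x 0⟩, fun h => hx0 (congrArg WithLp.fst h), ?_⟩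
  rw [H_apply, A.map_zero, hx]
  refine WithLp.ofLp_injective 2 (Prod.ext ?_ ?_)
  · change ((k * Real.pi : ℝ) : ℂ) • (x : X) + (0 + 0) = ((k : ℂ) * (Real.pi : ℂ)) • (x : X)
    simp
  · change -(0 : X) = ((k : ℂ) * (Real.pi : ℂ)) • (0 : X)
    simp

/-- If a finite-dimensional subspace `U` is invariant under `A` and contains the kernels of
`A - r` and `A + r`, then `U × U` contains the root subspace of `H` at `r`. -/
theorem kerPow_H_le (U : Submodule ℂ X) [FiniteDimensional ℂ U]
    (hU : ∀ x ∈ U, ∃ h : x ∈ A.domain, A ⟨x, h⟩ ∈ U) (r : ℝ)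
    (hker : ∀ x : A.domain, A x - (r : ℂ) • (x : X) = 0 → (x : X) ∈ U)
    (hker' : ∀ x : A.domain, A x - ((-r : ℝ) : ℂ) • (x : X) = 0 → (x : X) ∈ U) (n : ℕ) :
    kerPow H r n ≤
      (U.prod U).map ((WithLp.linearEquiv 2 ℂ (X × X)).symm : X × X →ₗ[ℂ] WithLp 2 (X × X)) := by
  have hmem : ∀ x : WithLp 2 (X × X), x ∈ (U.prod U).map
      ((WithLp.linearEquiv 2 ℂ (X × X)).symm : X × X →ₗ[ℂ] WithLp 2 (X × X)) ↔
      x.fst ∈ U ∧ x.snd ∈ U := by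
    intro x
    constructor
    · rintro ⟨y, hy, rfl⟩
      exact hy
    · exact fun h => ⟨(x.fst, x.snd), h, rfl⟩
  induction n with
  | zero => exact bot_le
  | succ n ih =>
    rintro x ⟨hx, hxn⟩
    obtain ⟨p, q, h, hpq⟩ := exists_of_H_domain ⟨x, hx⟩
    obtain rfl : x = WithLp.toLp 2 ((p : X), (q : X)) := congrArg Subtype.val hpq
    rw [H_apply] at hxn
    obtain ⟨h1, h2⟩ := (hmem _).1 (ih hxn)
    change A p + (A q + q) - (r : ℂ) • (p : X) ∈ U at h1
    change -A q - (r : ℂ) • (q : X) ∈ U at h2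
    have hq : (q : X) ∈ U := by
      refine mem_of_sub_smul_mem isFormalAdjoint_A U hU (-r) hker' q ?_
      convert U.neg_mem h2 using 1
      push_cast
      module
    have hAq : A q ∈ U := (hU q hq).2
    refine (hmem _).2 ⟨mem_of_sub_smul_mem isFormalAdjoint_A U hU r hker p ?_, hq⟩
    convert U.sub_mem h1 (U.add_mem hAq hq) using 1
    abel

theorem finiteDimensional_rootSubspace_H {z : ℂ} (hz : z ∈ piMultiples) :
    FiniteDimensional ℂ (rootSubspace H z) := by
  obtain ⟨k, rfl⟩ := hz
  obtain ⟨x, -, hx, hkx⟩ := exists_span_A_eigenvector k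
  obtain ⟨y, -, hy, hky⟩ := exists_span_A_eigenvector (-k)
  set U := Submodule.span ℂ {(x : X), (y : X)}
  have hxU : (x : X) ∈ U := Submodule.subset_span (by simp)
  have hyU : (y : X) ∈ U := Submodule.subset_span (by simp)
  have hfin : FiniteDimensional ℂ U := FiniteDimensional.span_of_finite ℂ (toFinite _)
  have hinv : ∀ w ∈ U, ∃ h : w ∈ A.domain, A ⟨w, h⟩ ∈ U := by
    intro w hw
    obtain ⟨a, b, rfl⟩ := Submodule.mem_span_pair.1 hw
    have h : A (a • x + b • y) ∈ U := by
      rw [A.map_add, A.map_smul, A.map_smul, hx, hy]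
      exact U.add_mem (U.smul_mem _ (U.smul_mem _ hxU)) (U.smul_mem _ (U.smul_mem _ hyU))
    exact ⟨(a • x + b • y).2, h⟩
  have hle := kerPow_H_le U hinv (k * Real.pi)
    (fun w hw => Submodule.span_mono (by simp) (hkx w hw))
    (fun w hw => Submodule.span_mono (by simp) (hky w (by
      rwa [Int.cast_neg, neg_mul])))
  rw [Complex.ofReal_mul, Complex.ofReal_intCast] at hle
  have hprod : FiniteDimensional ℂ (U.prod U) :=
    Module.Finite.iff_fg.2 ((Module.Finite.iff_fg.1 hfin).prod (Module.Finite.iff_fg.1 hfin))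
  exact Submodule.finiteDimensional_of_le (iSup_le hle)

end PlateBending

theorem mainTheorem8 :
    PlateBending.IsSymplecticSelfAdjoint PlateBending.A (PlateBending.A + PlateBending.one) 0
        (-PlateBending.A) ∧
      PlateBending.spectrumSet PlateBending.H = PlateBending.pointSpectrum PlateBending.H ∧
      PlateBending.pointSpectrum PlateBending.H =
        {z : ℂ | ∃ k : ℤ, z = (k : ℂ) * (Real.pi : ℂ)} ∧
      ∀ z ∈ PlateBending.spectrumSet PlateBending.H,
        FiniteDimensional ℂ (PlateBending.rootSubspace PlateBending.H z) := by
  have h1 := PlateBending.pointSpectrum_subset_spectrumSet PlateBending.H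
  have h2 := PlateBending.spectrumSet_H_subset
  have h3 := PlateBending.piMultiples_subset_pointSpectrum_H
  exact ⟨⟨PlateBending.isHamiltonian_H, PlateBending.symplecticUnit_compPMap_H_adjoint⟩,
    (h2.trans h3).antisymm h1, (h1.trans h2).antisymm h3,
    fun z hz => PlateBending.finiteDimensional_rootSubspace_H (h2 hz)⟩
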